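/- Theorem 4. Fix a non-empty set of atoms $At$. A model $M=(S,\to,\mathcal V,\mathcal C)$ consists of a non-empty set $S$ of states, a serial relation $\to\,\subseteq S\times S$, a valuation $\mathcal V: At\to 2^S$ and a cost function $\mathcal C: S\times S\to\mathbb N^+$; a pointed model is a model with a chosen state. Formulae of Strategic Deconstruction Logic (SDL) are $\varphi ::= p\mid\neg\varphi\mid\varphi\wedge\varphi\mid\langle n\rangle\psi$ with $\psi ::= \mathsf X\varphi\mid\varphi\,\mathsf U\,\varphi\mid\varphi\,\mathsf R\,\varphi$, for $p\in At$ and $n\in\mathbb N$; as usual $\mathsf F\varphi:=\top\,\mathsf U\,\varphi$. A demonic strategy assigns to each pointed model a set $A$ of its edges whose removal leaves the relation serial; it is an $n$-strategy if the total cost of the chosen set is always at most $n$. In each round the chosen edges are removed permanently, and then the traveller moves from the current state along a remaining edge; this produces infinite sequences of pointed models. $\langle n\rangle\psi$ holds in a pointed model iff some $n$-strategy is such that all sequences that start there and are compatible with it satisfy the path formula $\psi$ (with the usual meaning of $\mathsf X$ (next), $\mathsf U$ (until), $\mathsf R$ (release)). Formulae of Obstruction Logic (OL) are $\varphi ::=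 \top\mid p\mid\neg\varphi\mid\varphi\wedge\varphi\mid\langle\dagger^n\rangle\psi$ with $\psi$ built in the same way. $\langle\dagger^n\rangle\psi$ holds at $(M,s)$ iff there is a function that assigns to each state of $M$ a proper subset, of total cost at most $n$, of its outgoing edges, such that every infinite path of $M$ from $s$ that never uses an edge disabled in the state where it is taken satisfies $\psi$. So the edges disabled in a round are restored after the traveller's move. A formula of SDL and a formula of OL are equivalent if they hold in the same pointed models. Then SDL is not expressible in OL: $\mathrm{SDL}\not\preccurlyeq\mathrm{OL}$, i.e. not every SDL formula has an equivalent OL formula. In particular, for an atom $p$, the SDL formula $\langle 1\rangle\mathsf F p$ has no equivalent OL formula. More precisely, for $n\ge 0$ and $k\ge 1$ let $M_{n,k}$ be the model with states $s_1,\dots,s_{n+1},t_1,\dots,t_k$ and edges $s_i\to s_{i+1}$ ($1\le i\le n$), $s_{n+1}\to t_j$ and $t_j\to t_j$ ($1\le j\le k$), in which all costs are $1$, $p$ is true only in $t_1$, and the other atoms are true nowhere. Then for every $n\ge 0$: 1. $(M_{n,n+2},s_1)\models\langle 1\rangle\mathsf F p$; 2. $(M_{n,n+3},s_1)\not\models\langle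 1\rangle\mathsf F p$; 3. for every OL formula $\varphi$ all of whose resource bounds are at most $n$, $(M_{n,n+2},s_1)\models\varphi$ if and only if $(M_{n,n+3},s_1)\models\varphi$. -/

import Mathlib

universe u

/-- A model over the set of atoms `At` with set of states `S`: a serial relation, a valuation,
and a positive integer cost for *every* pair of states. -/
structure Model (At : Type*) (S : Type) where
  edges : Set (S × S)
  serial : ∀ s, ∃ t, (s, t) ∈ edges
  val : At → Set S
  cost : S × S → ℕ+

/-- A pointed model (its set of states is automatically non-empty). -/
structure PointedModel (At : Type*) (S : Type) where
  model : Model At S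
  state : S

namespace Model

variable {At : Type*} {S : Type}

/-- `M \ A`, for a set of edges `A` whose removal leaves the relation serial. -/
def remove (M : Model At S) (A : Set (S × S)) (h : ∀ s, ∃ t, (s, t) ∈ M.edges \ A) :
    Model At S where
  edges := M.edges \ A
  serial := h
  val := M.val
  cost := M.cost

/-- `C(A) ≤ n`. As all costs are at least `1`, this forces `A` to be finite. -/
def CostLE (M : Model At S) (A : Set (S × S)) (n : ℕ) : Prop :=
  ∃ F : Finset (S × S), (F : Set (S × S)) = A ∧ ∑ e ∈ F, (M.cost e : ℕ) ≤ n

end Model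

namespace SDL

mutual
/-- State formulae of Strategic Deconstruction Logic, that is, the formulae of SDL. -/
inductive Formula (At : Type u) where
  | atom : At → Formula At
  | neg : Formula At → Formula At
  | and : Formula At → Formula At → Formula At
  | demon : ℕ → PathFormula At → Formula At
/-- Path formulae of Strategic Deconstruction Logic. -/
inductive PathFormula (At : Type u) where
  | next : Formula At → PathFormula At
  | untl : Formula At → Formula At → PathFormula At
  | release : Formula At → Formula At → PathFormula At
end

/-- `⊤`, written in the language as `¬ (φ ∧ ¬ φ)`. -/
def Formula.top {At : Type*} (φ : Formula At) : Formula At := .neg (.and φ (.neg φ))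

/-- `F φ := ⊤ U φ`. -/
def PathFormula.sometime {At : Type*} (φ : Formula At) : PathFormula At := .untl φ.top φ

variable {At : Type*} {S : Type}

/-- Deconstruction accessibility with cost at most `n`. -/
def DeconstructionAccessible (n : ℕ) (P Q : PointedModel At S) : Prop :=
  ∃ (A : Set (S × S)) (h : ∀ s, ∃ t, (s, t) ∈ P.model.edges \ A),
    A ⊂ P.model.edges ∧ Q.model = P.model.remove A h ∧
      (P.state, Q.state) ∈ Q.model.edges ∧ P.model.CostLE A n

/-- A decreasing model path with cost `n`. -/
def IsDecreasingPath (n : ℕ) (π : ℕ → PointedModel At S) : Prop :=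
  ∀ i, DeconstructionAccessible n (π i) (π (i + 1))

/-- A demonic strategy chooses in every pointed model a set of edges to remove, in such a way that
what remains is a model, i.e. is serial. -/
structure Strategy (At : Type*) (S : Type) where
  choice : PointedModel At S → Set (S × S)
  ssubset : ∀ P, choice P ⊂ P.model.edges
  serial : ∀ P s, ∃ t, (s, t) ∈ P.model.edges \ choice P

/-- An infinite sequence of pointed models is compatible with a strategy if every next model is
obtained by removing the edges chosen by the strategy, and the traveller then moves along a
remaining edge. -/
def Compatible (σ : Strategy At S) (π : ℕ → PointedModel At S) : Prop :=
  ∀ i, (π (i + 1)).model = (π i).model.remove (σ.choice (π i)) (σ.serial (π i)) ∧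
    ((π i).state, (π (i + 1)).state) ∈ (π (i + 1)).model.edges

/-- `Out(σ, P)`. -/
def Out (σ : Strategy At S) (P : PointedModel At S) : Set (ℕ → PointedModel At S) :=
  {π | Compatible σ π ∧ π 0 = P}

/-- `σ` is an `n`-strategy: all paths compatible with it, from whatever start, have cost `n`. -/
def IsNStrategy (n : ℕ) (σ : Strategy At S) : Prop :=
  ∀ π, Compatible σ π → IsDecreasingPath n π

mutual
/-- Satisfaction of SDL formulae in pointed models. -/
def Sat : Formula At → PointedModel At S → Prop
  | .atom p, P => P.state ∈ P.model.val p
  | .neg φ, P => ¬ Sat φ P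
  | .and φ ψ, P => Sat φ P ∧ Sat ψ P
  | .demon n ψ, P => ∃ σ : Strategy At S, IsNStrategy n σ ∧ ∀ π ∈ Out σ P, PathSat ψ π
/-- Satisfaction of SDL path formulae on sequences of pointed models. -/
def PathSat : PathFormula At → (ℕ → PointedModel At S) → Prop
  | .next φ, π => Sat φ (π 1)
  | .untl φ ψ, π => ∃ j, Sat ψ (π j) ∧ ∀ i < j, Sat φ (π i)
  | .release φ ψ, π => (∀ j, Sat ψ (π j)) ∨ ∃ k, Sat φ (π k) ∧ ∀ i ≤ k, Sat ψ (π i)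
end

end SDL

namespace OL

mutual
/-- State formulae of Obstruction Logic, that is, the formulae of OL. -/
inductive Formula (At : Type u) where
  | top : Formula At
  | atom : At → Formula At
  | neg : Formula At → Formula At
  | and : Formula At → Formula At → Formula At
  | demon : ℕ → PathFormula At → Formula At
/-- Path formulae of Obstruction Logic. -/
inductive PathFormula (At : Type u) where
  | next : Formula At → PathFormula At
  | untl : Formula At → Formula At → PathFormula At
  | release : Formula At → Formula At → PathFormula At
end

mutual
/-- The largest resource bound in an OL formula (`0` if there is none). -/
def Formula.maxBound {At : Type*} : Formula At → ℕ
  | .top => 0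
  | .atom _ => 0
  | .neg φ => φ.maxBound
  | .and φ ψ => max φ.maxBound ψ.maxBound
  | .demon n ψ => max n ψ.maxBound
/-- The largest resource bound in an OL path formula (`0` if there is none). -/
def PathFormula.maxBound {At : Type*} : PathFormula At → ℕ
  | .next φ => φ.maxBound
  | .untl φ ψ => max φ.maxBound ψ.maxBound
  | .release φ ψ => max φ.maxBound ψ.maxBound
end

variable {At : Type*} {S : Type}

/-- An obstruction strategy with bound `n` on the (never changing) model `M`: in every state it
temporarily disables some, but not all, of the outgoing edges, of total cost at most `n`. -/
structure Strategy (M : Model At S) (n : ℕ) where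
  choice : S → Set (S × S)
  ssubset : ∀ s, choice s ⊂ {e | e ∈ M.edges ∧ e.1 = s}
  cost_le : ∀ s, M.CostLE (choice s) n

/-- The infinite paths of `M` from `s` on which the traveller never uses an edge that is disabled
at the moment of the move; all edges are restored after each move. -/
def Out {M : Model At S} {n : ℕ} (σ : Strategy M n) (s : S) : Set (ℕ → S) :=
  {π | π 0 = s ∧ ∀ i, (π i, π (i + 1)) ∈ M.edges \ σ.choice (π i)}

mutual
/-- Satisfaction of OL formulae in the states of a model. -/
def SatAt (M : Model At S) : Formula At → S → Prop
  | .top, _ => True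
  | .atom p, s => s ∈ M.val p
  | .neg φ, s => ¬ SatAt M φ s
  | .and φ ψ, s => SatAt M φ s ∧ SatAt M ψ s
  | .demon n ψ, s => ∃ σ : Strategy M n, ∀ π ∈ Out σ s, PathSat M ψ π
/-- Satisfaction of OL path formulae on paths of a model. -/
def PathSat (M : Model At S) : PathFormula At → (ℕ → S) → Prop
  | .next φ, π => SatAt M φ (π 1)
  | .untl φ ψ, π => ∃ j, SatAt M ψ (π j) ∧ ∀ i < j, SatAt M φ (π i)
  | .release φ ψ, π =>
      (∀ j, SatAt M ψ (π j)) ∨ ∃ k, SatAt M φ (π k) ∧ ∀ i ≤ k, SatAt M ψ (π i)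
end

/-- Satisfaction of OL formulae in pointed models. -/
def Sat (φ : Formula At) (P : PointedModel At S) : Prop := SatAt P.model φ P.state

end OL

/-- A satisfaction relation between the formulae of a language `L` and all pointed models. -/
abbrev Semantics (At : Type*) (L : Type*) := L → ∀ S : Type, PointedModel At S → Prop

/-- A formula of one language and a formula of another are equivalent if they hold in the same
pointed models. -/
def EquivalentFormulae {At L₁ L₂ : Type*} (sat₁ : Semantics At L₁) (sat₂ : Semantics At L₂)
    (φ : L₁) (ψ : L₂) : Prop :=
  ∀ (S : Type) (P : PointedModel At S), sat₁ φ S P ↔ sat₂ ψ S P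

/-- `L₁ ≼ L₂`: the language `L₂` is at least as expressive as `L₁`. -/
def ExpressivityLE {At L₁ L₂ : Type*} (sat₁ : Semantics At L₁) (sat₂ : Semantics At L₂) : Prop :=
  ∀ φ : L₁, ∃ ψ : L₂, EquivalentFormulae sat₁ sat₂ φ ψ

/-- SDL as a language interpreted in pointed models. -/
def SDL.semantics (At : Type*) : Semantics At (SDL.Formula At) := fun φ _ P => SDL.Sat φ P

/-- OL as a language interpreted in pointed models. -/
def OL.semantics (At : Type*) : Semantics At (OL.Formula At) := fun φ _ P => OL.Sat φ P

/-- The edges of the fan model: a chain of `n + 1` states `s_1 → ... → s_{n+1}` (left summand),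
edges from `s_{n+1}` to all of the states `t_1, ..., t_k` (right summand), and a loop at each `t_i`.
The indices in `Fin` are shifted by one. -/
def fanEdge (n k : ℕ) : Fin (n + 1) ⊕ Fin k → Fin (n + 1) ⊕ Fin k → Prop
  | .inl i, .inl j => j.val = i.val + 1
  | .inl i, .inr _ => i.val = n
  | .inr _, .inl _ => False
  | .inr i, .inr j => i = j

/-- The fan model with `n + 1` chain states and `k` fan states; all costs are `1`, and the atom `p`
holds exactly in `t_1`, while all other atoms hold nowhere. -/
def fanModel {At : Type*} (p : At) (n k : ℕ) [NeZero k] : Model At (Fin (n + 1) ⊕ Fin k) where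
  edges := {e | fanEdge n k e.1 e.2}
  serial := by
    rintro (i | i)
    · by_cases h : i.val = n
      · exact ⟨.inr 0, h⟩
      · exact ⟨.inl ⟨i.val + 1, by omega⟩, rfl⟩
    · exact ⟨.inr i, rfl⟩
  val := fun q => {s | q = p ∧ s = .inr 0}
  cost := fun _ => 1

/-- The fan model pointed at the first chain state `s_1`. -/
def fan {At : Type*} (p : At) (n k : ℕ) [NeZero k] : PointedModel At (Fin (n + 1) ⊕ Fin k) :=
  ⟨fanModel p n k, .inl 0⟩

/-!
In SDL with resource bound `1`, the demon removes at most one edge per round, and removed edges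
stay removed. While the traveller walks along the chain of `n + 1` states, the demon can therefore
delete up to `n + 1` edges of the fan, and no more; afterwards the traveller is trapped in a loop.
Hence the demon can force the traveller into
`t_1` if there are `n + 2` edges in the fan (`SDL.sat_fan`): from the `i`-th chain state it
deletes the edge to `t_{i+1}`. If there are `n + 3` edges, then an edge to some `t_j` with `j ≠ 1`
survives every strategy (`SDL.not_sat_fan`), because the number of surviving edges of this kind is
still at least two when the traveller reaches the end of the chain.

In OL the edges come back after each move. If all resource bounds are at most `n`, and the fan has
at least `n + 2` edges, then at the end of the chain the demon cannot block all edges to the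
`t_j` with `j ≠ 1`; its only choice that matters is whether to block the edge to `t_1`. So the
number of edges in the fan is invisible: identifying all the `t_j` with `j ≠ 1` (`fanClass`) gives a
bisimulation between any two such fans (`OL.exists_simulating_strategy`), and OL formulae with bounds
at most `n` cannot tell related states apart (`OL.satAt_iff_of_fanClass_eq`). A putative OL
equivalent of `⟨1⟩ F p` is refuted by the two fans for `n` the largest of its bounds.
-/

/-! ### Costs and fans -/

/-- As all costs are positive, a set of cost at most `m` contains at most `m` edges of the fan. -/
theorem Model.CostLE.ncard_fan_le {At : Type*} {n k m : ℕ}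
    {M : Model At (Fin (n + 1) ⊕ Fin k)} {A : Set ((Fin (n + 1) ⊕ Fin k) × (Fin (n + 1) ⊕ Fin k))}
    (h : M.CostLE A m) : {j : Fin k | (.inl (Fin.last n), .inr j) ∈ A}.ncard ≤ m := by
  obtain ⟨F, rfl, hF⟩ := h
  have hcard : F.card ≤ ∑ e ∈ F, (M.cost e : ℕ) := by
    simpa using Finset.card_nsmul_le_sum F (fun e => (M.cost e : ℕ)) 1 fun e _ => (M.cost e).pos
  let f : Fin k → (Fin (n + 1) ⊕ Fin k) × (Fin (n + 1) ⊕ Fin k) :=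
    fun j => (.inl (Fin.last n), .inr j)
  have hle : {j : Fin k | f j ∈ (F : Set _)}.ncard ≤ (F : Set _).ncard :=
    Set.ncard_le_ncard_of_injOn f (fun _ hj => hj)
      (fun i _ j _ hij => by simpa [f] using hij) F.finite_toSet
  rw [Set.ncard_coe_finset] at hle
  exact hle.trans (hcard.trans hF)

theorem ncard_ne_zero_fin (k : ℕ) [NeZero k] : {j : Fin k | j ≠ 0}.ncard = k - 1 := by
  have h : {j : Fin k | j ≠ 0} = {0}ᶜ := rfl
  rw [h, Set.ncard_compl, Set.ncard_singleton, Nat.card_eq_fintype_card, Fintype.card_fin]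

/-! ### Plays of Strategic Deconstruction Logic -/

namespace SDL

variable {At : Type*} {S : Type}

/-- An invariant that the traveller can maintain for one round, whatever the strategy, is maintained
along some compatible infinite sequence. -/
theorem exists_mem_out_forall (σ : Strategy At S) (I : PointedModel At S → Prop)
    (step : ∀ P, I P → ∃ t, (P.state, t) ∈ P.model.edges \ σ.choice P ∧
      I ⟨P.model.remove (σ.choice P) (σ.serial P), t⟩)
    {P : PointedModel At S} (hP : I P) : ∃ π ∈ Out σ P, ∀ i, I (π i) := by
  choose t ht hI using step
  let next : {P // I P} → {P // I P} := fun Q => ⟨_, hI Q.1 Q.2⟩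
  refine ⟨fun i => (next^[i] ⟨P, hP⟩).1, ⟨fun i => ?_, rfl⟩, fun i => (next^[i] ⟨P, hP⟩).2⟩
  simp only [Function.iterate_succ_apply']
  exact ⟨rfl, ht _ _⟩

theorem IsNStrategy.costLE_choice {n : ℕ} {σ : Strategy At S} (hσ : IsNStrategy n σ)
    (P : PointedModel At S) : P.model.CostLE (σ.choice P) n := by
  obtain ⟨π, ⟨hπ, rfl⟩, -⟩ := exists_mem_out_forall σ (fun _ => True)
    (fun P _ => (σ.serial P P.state).imp fun _ ht => ⟨ht, trivial⟩) (P := P) trivial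
  obtain ⟨A, hA, hss, hQ, -, hcost⟩ := hσ π hπ 0
  have hedges : (π 0).model.edges \ A = (π 0).model.edges \ σ.choice (π 0) := by
    rw [(hπ 0).1] at hQ
    exact (congrArg Model.edges hQ).symm
  -- Both sets consist of edges, so they are determined by what they leave over.
  have : A = σ.choice (π 0) := by
    rw [← Set.sdiff_sdiff_cancel_left hss.1, hedges,
      Set.sdiff_sdiff_cancel_left (σ.ssubset (π 0)).1]
  exact this ▸ hcost

/-- The set `A` may be removed from `M` by an `n`-strategy. -/
def Removable (M : Model At S) (n : ℕ) (A : Set (S × S)) : Prop :=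
  A ⊂ M.edges ∧ (∀ s, ∃ t, (s, t) ∈ M.edges \ A) ∧ M.CostLE A n

theorem removable_empty (P : PointedModel At S) (n : ℕ) : Removable P.model n ∅ := by
  refine ⟨?_, fun s => by simpa using P.model.serial s, ∅, by simp, by simp⟩
  obtain ⟨t, ht⟩ := P.model.serial P.state
  exact Set.empty_ssubset.2 ⟨_, ht⟩

open Classical in
/-- The strategy that removes `f P` where this is possible at cost at most `n`, and otherwise removes
nothing. -/
noncomputable def Strategy.ofRemoval (n : ℕ) (f : PointedModel At S → Set (S × S)) :
    Strategy At S where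
  choice P := if Removable P.model n (f P) then f P else ∅
  ssubset P := by
    split_ifs with h
    exacts [h.1, (removable_empty P n).1]
  serial P := by
    split_ifs with h
    exacts [h.2.1, (removable_empty P n).2.1]

theorem Strategy.ofRemoval_choice {n : ℕ} {f : PointedModel At S → Set (S × S)}
    {P : PointedModel At S} (h : Removable P.model n (f P)) :
    (Strategy.ofRemoval n f).choice P = f P := if_pos h

theorem Strategy.isNStrategy_ofRemoval (n : ℕ) (f : PointedModel At S → Set (S × S)) :
    IsNStrategy n (Strategy.ofRemoval n f) := by
  intro π hπ i
  refine ⟨_, (Strategy.ofRemoval n f).serial (π i), (Strategy.ofRemoval n f).ssubset (π i),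
    (hπ i).1, (hπ i).2, ?_⟩
  simp only [Strategy.ofRemoval]
  split_ifs with h
  exacts [h.2.2, (removable_empty (π i) n).2.2]

/-! ### The formula `⟨1⟩ F p` in the fans -/

theorem pathSat_sometime_atom (p : At) (π : ℕ → PointedModel At S) :
    PathSat (.sometime (.atom p)) π ↔ ∃ j, (π j).state ∈ (π j).model.val p := by
  simp [PathFormula.sometime, Formula.top, PathSat, Sat]

/-- In the chain state with index `i`, remove the edge to the fan state with index `i + 1`. -/
def fanRemoval (n : ℕ) (P : PointedModel At (Fin (n + 1) ⊕ Fin (n + 2))) :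
    Set ((Fin (n + 1) ⊕ Fin (n + 2)) × (Fin (n + 1) ⊕ Fin (n + 2))) :=
  match P.state with
  | .inl i => {(.inl (Fin.last n), .inr i.succ)}
  | .inr _ => ∅

theorem sat_fan (p : At) (n : ℕ) :
    Sat (.demon 1 (.sometime (.atom p))) (fan p n (n + 2)) := by
  rw [Sat]
  refine ⟨.ofRemoval 1 (fanRemoval n), Strategy.isNStrategy_ofRemoval _ _, ?_⟩
  rintro π ⟨hπ, h0⟩
  rw [pathSat_sometime_atom]
  have hval : ∀ i, (π i).model.val = (fanModel p n (n + 2)).val := by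
    intro i
    induction i with
    | zero => rw [h0]; rfl
    | succ i ih => rw [(hπ i).1]; exact ih
  have hcost : ∀ i, (π i).model.cost = fun _ => 1 := by
    intro i
    induction i with
    | zero => rw [h0]; rfl
    | succ i ih => rw [(hπ i).1]; exact ih
  -- The edges to the fan states with indices `1, ..., i` have been removed before round `i`.
  let E : ℕ → Set ((Fin (n + 1) ⊕ Fin (n + 2)) × (Fin (n + 1) ⊕ Fin (n + 2))) := fun i =>
    {e | fanEdge n (n + 2) e.1 e.2 ∧
      ∀ j : Fin (n + 2), e = (.inl (Fin.last n), .inr j) → j = 0 ∨ i < j.val}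
  have hstep : ∀ i (hi : i < n + 1), (π i).state = .inl ⟨i, hi⟩ → (π i).model.edges = E i →
      (π (i + 1)).model.edges = E (i + 1) := by
    intro i hi hs hE
    have hf : fanRemoval n (π i) = {(.inl (Fin.last n), .inr (Fin.succ ⟨i, hi⟩))} := by
      simp [fanRemoval, hs]
    have hdiff : E i \ fanRemoval n (π i) = E (i + 1) := by
      ext e
      rw [hf]
      simp only [E, Set.mem_sdiff, Set.mem_ofPred_eq, Set.mem_singleton_iff]
      constructor
      · rintro ⟨⟨he, h⟩, hne⟩
        refine ⟨he, fun j hj => ?_⟩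
        rcases h j hj with h | h
        · exact .inl h
        · refine .inr (lt_of_le_of_ne h fun hij => hne ?_)
          rw [hj]
          simp [Fin.ext_iff, ← hij]
      · rintro ⟨he, h⟩
        refine ⟨⟨he, fun j hj => (h j hj).imp_right fun h => by omega⟩, fun heq => ?_⟩
        rcases h _ heq with h | h
        · exact Fin.succ_ne_zero _ h
        · simp at h
    have hserial : ∀ s, ∃ t, (s, t) ∈ E (i + 1) := by
      rintro (s | s)
      · by_cases h : s.val = n
        · exact ⟨.inr 0, h, by simp⟩
        · exact ⟨.inl ⟨s.val + 1, by omega⟩, rfl, by simp⟩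
      · exact ⟨.inr s, rfl, by simp⟩
    have hrem : Removable (π i).model 1 (fanRemoval n (π i)) := by
      refine ⟨?_, by rw [hE, hdiff]; exact hserial, ?_⟩
      · rw [hE]
        refine Set.ssubset_iff_subset_ne.2 ⟨?_, fun h => ?_⟩
        · rw [hf, Set.singleton_subset_iff]
          refine ⟨rfl, fun j hj => .inr ?_⟩
          obtain rfl : Fin.succ ⟨i, hi⟩ = j := by simpa using hj
          simp
        · obtain ⟨t, ht⟩ := hserial (.inl 0)
          rw [← hdiff, h, sdiff_self] at ht
          exact ht
      · rw [hf]
        exact ⟨{(.inl (Fin.last n), .inr (Fin.succ ⟨i, hi⟩))}, by simp, by simp [hcost]⟩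
    rw [(hπ i).1]
    change (π i).model.edges \ _ = _
    rw [Strategy.ofRemoval_choice hrem, hE, hdiff]
  have hinv : ∀ i (hi : i < n + 1), (π i).state = .inl ⟨i, hi⟩ ∧ (π i).model.edges = E i := by
    intro i
    induction i with
    | zero =>
      intro _
      rw [h0]
      refine ⟨rfl, ?_⟩
      ext e
      refine ⟨fun he => ⟨he, fun j _ => ?_⟩, fun he => he.1⟩
      exact (eq_or_ne j 0).imp_right fun h => Fin.pos_iff_ne_zero.2 h
    | succ i ih =>
      intro hi
      obtain ⟨hs, hE⟩ := ih (by omega)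
      have hE' := hstep i (by omega) hs hE
      refine ⟨?_, hE'⟩
      have hmove := (hπ i).2
      rw [hE', hs] at hmove
      have hedge := hmove.1
      rcases h : (π (i + 1)).state with j | j
      · rw [h] at hedge
        exact congrArg Sum.inl (Fin.ext hedge)
      · rw [h] at hedge
        simp only [fanEdge] at hedge
        omega
  obtain ⟨hs, hE⟩ := hinv n (by omega)
  have hmove := (hπ n).2
  rw [hstep n (by omega) hs hE, hs] at hmove
  refine ⟨n + 1, ?_⟩
  rw [hval]
  refine ⟨rfl, ?_⟩
  obtain ⟨hedge, hj⟩ := hmove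
  rcases h : (π (n + 1)).state with j | j
  · rw [h] at hedge
    simp only [fanEdge] at hedge
    omega
  · rw [h] at hj
    rcases hj j rfl with h | h
    · rw [h]
    · omega

theorem not_sat_fan (p : At) (n : ℕ) :
    ¬ Sat (.demon 1 (.sometime (.atom p))) (fan p n (n + 3)) := by
  rw [Sat]
  rintro ⟨σ, hσ, hout⟩
  -- On the chain, at least one unwanted edge of the fan must be left over for each round to come,
  -- and one more for the traveller's move.
  let I : PointedModel At (Fin (n + 1) ⊕ Fin (n + 3)) → Prop := fun P =>
    P.model.edges ⊆ (fanModel p n (n + 3)).edges ∧ P.model.val = (fanModel p n (n + 3)).val ∧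
      ((∃ i : Fin (n + 1), P.state = .inl i ∧ n + 2 ≤ i.val +
          {j : Fin (n + 3) | j ≠ 0 ∧ (.inl (Fin.last n), .inr j) ∈ P.model.edges}.ncard) ∨
        ∃ j : Fin (n + 3), P.state = .inr j ∧ j ≠ 0)
  have step : ∀ P, I P → ∃ t, (P.state, t) ∈ P.model.edges \ σ.choice P ∧
      I ⟨P.model.remove (σ.choice P) (σ.serial P), t⟩ := by
    rintro P ⟨hsub, hval, hstate⟩
    have hsub' : (P.model.remove (σ.choice P) (σ.serial P)).edges ⊆
        (fanModel p n (n + 3)).edges := Set.sdiff_subset.trans hsub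
    rcases hstate with ⟨i, hi, hcount⟩ | ⟨j, hj, hj0⟩
    · have hcount' : n + 2 ≤ i.val + {j : Fin (n + 3) | j ≠ 0 ∧
          (Sum.inl (Fin.last n), Sum.inr j) ∈ P.model.edges \ σ.choice P}.ncard + 1 := by
        have hle := (hσ.costLE_choice P).ncard_fan_le
        have hcover := Set.ncard_le_ncard (s := {j : Fin (n + 3) | j ≠ 0 ∧
            (Sum.inl (Fin.last n), Sum.inr j) ∈ P.model.edges})
          (t := {j : Fin (n + 3) | j ≠ 0 ∧
            (Sum.inl (Fin.last n), Sum.inr j) ∈ P.model.edges \ σ.choice P} ∪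
            {j : Fin (n + 3) | (Sum.inl (Fin.last n), Sum.inr j) ∈ σ.choice P})
          (fun j hj => by
            by_cases h : (Sum.inl (Fin.last n), Sum.inr j) ∈ σ.choice P
            exacts [.inr h, .inl ⟨hj.1, hj.2, h⟩]) (Set.toFinite _)
        have hunion := Set.ncard_union_le {j : Fin (n + 3) | j ≠ 0 ∧
            (Sum.inl (Fin.last n), Sum.inr j) ∈ P.model.edges \ σ.choice P}
            {j : Fin (n + 3) | (Sum.inl (Fin.last n), Sum.inr j) ∈ σ.choice P}
        omega
      by_cases hin : i.val = n
      · obtain ⟨j, hj0, hj⟩ := Set.nonempty_of_ncard_ne_zero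
          (show {j : Fin (n + 3) | j ≠ 0 ∧
            (Sum.inl (Fin.last n), Sum.inr j) ∈ P.model.edges \ σ.choice P}.ncard ≠ 0 by omega)
        obtain rfl : i = Fin.last n := Fin.ext hin
        exact ⟨.inr j, by rwa [hi], hsub', hval, .inr ⟨j, rfl, hj0⟩⟩
      · obtain ⟨t, ht⟩ := σ.serial P P.state
        refine ⟨t, ht, hsub', hval, .inl ?_⟩
        have hedge := hsub ht.1
        rw [hi] at hedge
        rcases t with t | t
        · replace hedge : t.val = i.val + 1 := hedge
          refine ⟨t, rfl, ?_⟩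
          change n + 2 ≤ t.val + {j : Fin (n + 3) | j ≠ 0 ∧
            (Sum.inl (Fin.last n), Sum.inr j) ∈ P.model.edges \ σ.choice P}.ncard
          omega
        · exact absurd hedge hin
    · obtain ⟨t, ht⟩ := σ.serial P P.state
      refine ⟨t, ht, hsub', hval, .inr ⟨j, ?_, hj0⟩⟩
      have hedge := hsub ht.1
      rw [hj] at hedge
      rcases t with t | t
      · exact absurd hedge id
      · exact congrArg Sum.inr (Eq.symm hedge)
  have hinit : I (fan p n (n + 3)) := by
    refine ⟨subset_rfl, rfl, .inl ⟨0, rfl, ?_⟩⟩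
    have hset : {j : Fin (n + 3) | j ≠ 0 ∧
        (Sum.inl (Fin.last n), Sum.inr j) ∈ (fan p n (n + 3)).model.edges} = {j | j ≠ 0} :=
      Set.ext fun j => and_iff_left rfl
    rw [hset, ncard_ne_zero_fin]
    simp
  obtain ⟨π, hπ, hI⟩ := exists_mem_out_forall σ I step hinit
  obtain ⟨j, hj⟩ := (pathSat_sometime_atom p π).1 (hout π hπ)
  obtain ⟨-, hval, hstate⟩ := hI j
  rw [hval] at hj
  have hj0 := hj.2
  rcases hstate with ⟨i, hi, -⟩ | ⟨i, hi, hi0⟩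
  · rw [hi] at hj0
    cases hj0
  · rw [hi] at hj0
    exact hi0 (Sum.inr_injective hj0)

end SDL

/-! ### Fans and Obstruction Logic -/

/-- What Obstruction Logic sees of a state of a fan: chain states are kept apart, and of the fan
states only `t_1` (with value `True`) is distinguished from the others. -/
def fanClass {n k : ℕ} [NeZero k] : Fin (n + 1) ⊕ Fin k → Fin (n + 1) ⊕ Prop :=
  Sum.map id (· = 0)

theorem mem_val_iff_of_fanClass_eq {At : Type*} (p q : At) {n k k' : ℕ} [NeZero k] [NeZero k']
    {s : Fin (n + 1) ⊕ Fin k} {s' : Fin (n + 1) ⊕ Fin k'} (h : fanClass s = fanClass s') :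
    s ∈ (fanModel p n k).val q ↔ s' ∈ (fanModel p n k').val q := by
  rcases s with s | s <;> rcases s' with s' | s' <;> simp_all [fanClass, fanModel]

namespace OL

variable {At : Type*}

/-- A strategy cannot disable the only edge that leaves a state. -/
theorem Strategy.notMem_choice {S : Type} {M : Model At S} {m : ℕ} (σ : Strategy M m) {s t : S}
    (h : ∀ u, (s, u) ∈ M.edges → u = t) : (s, t) ∉ σ.choice s := by
  intro ht
  refine (σ.ssubset s).2 ?_
  rintro ⟨s', u⟩ ⟨he, rfl⟩
  exact h u he ▸ ht

/-- A strategy of bound at most `n` leaves one of the at least `n + 1` unwanted fan edges. -/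
theorem Strategy.exists_ne_zero_notMem_choice {p : At} {n k m : ℕ} [NeZero k] (hk : n + 2 ≤ k)
    (hm : m ≤ n) (σ : Strategy (fanModel p n k) m) :
    ∃ j : Fin k, j ≠ 0 ∧ (.inl (Fin.last n), .inr j) ∉ σ.choice (.inl (Fin.last n)) := by
  by_contra! h
  have hle := Set.ncard_le_ncard (s := {j : Fin k | j ≠ 0})
    (t := {j | (Sum.inl (Fin.last n), Sum.inr j) ∈ σ.choice (.inl (Fin.last n))})
    (fun j hj => h j hj) (Set.toFinite _)
  rw [ncard_ne_zero_fin] at hle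
  have := (σ.cost_le (.inl (Fin.last n))).ncard_fan_le
  omega

/-- The simulating strategy disables the edge to `t_1` if the given one does, and nothing else. The
given one must leave a fan edge to a state other than `t_1`, so the traveller has the same moves
against both, up to the identification of fan states by `fanClass`. -/
theorem exists_simulating_strategy (p : At) {n k k' m : ℕ} [NeZero k] [NeZero k']
    (hk : n + 2 ≤ k) (hk' : n + 2 ≤ k') (hm : m ≤ n) (σ : Strategy (fanModel p n k) m) :
    ∃ σ' : Strategy (fanModel p n k') m, ∀ s s', fanClass s = fanClass s' →
      ∀ t', (s', t') ∈ (fanModel p n k').edges \ σ'.choice s' →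
        ∃ t, (s, t) ∈ (fanModel p n k).edges \ σ.choice s ∧ fanClass t = fanClass t' := by
  let l : Fin (n + 1) ⊕ Fin k := .inl (Fin.last n)
  let l' : Fin (n + 1) ⊕ Fin k' := .inl (Fin.last n)
  let A : Set ((Fin (n + 1) ⊕ Fin k') × (Fin (n + 1) ⊕ Fin k')) :=
    {e | e = (l', .inr 0) ∧ (l, .inr 0) ∈ σ.choice l}
  have hcost : (fanModel p n k').CostLE A m := by
    by_cases h : (l, .inr 0) ∈ σ.choice l
    · refine ⟨{(l', .inr 0)}, by ext; simp [A, h], ?_⟩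
      -- The given strategy pays for the edge to `t_1`, so `m` is positive.
      obtain ⟨F, hF, hle⟩ := σ.cost_le l
      have hmem : (l, .inr 0) ∈ F := by rwa [← Finset.mem_coe, hF]
      have := Finset.single_le_sum (f := fun e => ((fanModel p n k).cost e : ℕ))
        (fun _ _ => Nat.zero_le _) hmem
      exact (by simpa [fanModel] using this.trans hle)
    · exact ⟨∅, by ext; simp [A, h], by simp⟩
  let σ' : Strategy (fanModel p n k') m :=
    { choice := fun s => {e | e ∈ A ∧ e.1 = s}
      ssubset := by
        intro s
        refine Set.ssubset_iff_subset_ne.2 ⟨?_, fun h => ?_⟩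
        · rintro e ⟨⟨rfl, -⟩, rfl⟩
          exact ⟨rfl, rfl⟩
        · by_cases hs : s = l'
          · have h1 : (l', .inr ⟨1, by omega⟩) ∈ {e | e ∈ (fanModel p n k').edges ∧ e.1 = s} :=
              ⟨rfl, hs.symm⟩
            rw [← h] at h1
            simpa [Fin.ext_iff] using h1.1.1
          · obtain ⟨t, ht⟩ := (fanModel p n k').serial s
            have h1 : (s, t) ∈ {e | e ∈ (fanModel p n k').edges ∧ e.1 = s} := ⟨ht, rfl⟩
            rw [← h] at h1
            exact hs (congrArg Prod.fst h1.1.1)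
      cost_le := by
        intro s
        by_cases hs : s = l'
        · convert hcost using 1
          ext e
          refine and_iff_left_of_imp ?_
          rintro ⟨rfl, -⟩
          exact hs.symm
        · refine ⟨∅, ?_, by simp⟩
          ext e
          simp only [Finset.coe_empty, Set.mem_empty_iff_false, false_iff]
          rintro ⟨⟨rfl, -⟩, rfl⟩
          exact hs rfl }
  refine ⟨σ', ?_⟩
  rintro (s | s) (s' | s') hss t' ⟨hedge, hnot⟩
  · obtain rfl : s = s' := Sum.inl_injective hss
    rcases t' with t' | t'
    · replace hedge : t'.val = s.val + 1 := hedge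
      refine ⟨.inl t', ⟨hedge, σ.notMem_choice ?_⟩, rfl⟩
      rintro (u | u) hu
      · replace hu : u.val = s.val + 1 := hu
        exact congrArg Sum.inl (Fin.ext (hu.trans hedge.symm))
      · replace hu : s.val = n := hu
        omega
    · obtain rfl : s = Fin.last n := Fin.ext hedge
      by_cases ht : t' = 0
      · subst ht
        exact ⟨.inr 0, ⟨rfl, fun h => hnot ⟨⟨rfl, h⟩, rfl⟩⟩, by simp [fanClass]⟩
      · obtain ⟨j, hj0, hj⟩ := σ.exists_ne_zero_notMem_choice hk hm
        exact ⟨.inr j, ⟨rfl, hj⟩, by simp [fanClass, hj0, ht]⟩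
  · cases hss
  · cases hss
  · rcases t' with t' | t'
    · exact absurd hedge id
    · obtain rfl : s' = t' := hedge
      refine ⟨.inr s, ⟨rfl, σ.notMem_choice ?_⟩, hss⟩
      rintro (u | u) hu
      · exact absurd hu id
      · exact congrArg Sum.inr (Eq.symm hu)

/-- If moves can be simulated along a relation `R`, then so can infinite paths. -/
theorem exists_path_of_simulation {S S' : Type} {E : S → S → Prop} {E' : S' → S' → Prop}
    {R : S → S' → Prop} (hR : ∀ s s', R s s' → ∀ t', E' s' t' → ∃ t, E s t ∧ R t t')
    {s : S} {π' : ℕ → S'} (hs : R s (π' 0)) (hπ' : ∀ i, E' (π' i) (π' (i + 1))) :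
    ∃ π : ℕ → S, π 0 = s ∧ (∀ i, E (π i) (π (i + 1))) ∧ ∀ i, R (π i) (π' i) := by
  choose f hE hf using fun (i : ℕ) (t : {t // R t (π' i)}) => hR t.1 (π' i) t.2 _ (hπ' i)
  let q : ∀ i, {t // R t (π' i)} := fun i =>
    Nat.rec ⟨s, hs⟩ (fun i t => ⟨f i t, hf i t⟩) i
  exact ⟨fun i => (q i).1, rfl, fun i => hE i (q i), fun i => (q i).2⟩

/-- A strategy that enforces a path property in one fan can be replaced by one in the other fan, if
the property is invariant under `fanClass`. -/
theorem exists_strategy_of_fanClass_eq (p : At) {n k k' m : ℕ} [NeZero k] [NeZero k']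
    (hk : n + 2 ≤ k) (hk' : n + 2 ≤ k') (hm : m ≤ n)
    {s : Fin (n + 1) ⊕ Fin k} {s' : Fin (n + 1) ⊕ Fin k'} (hs : fanClass s = fanClass s')
    {Q : (ℕ → Fin (n + 1) ⊕ Fin k) → Prop} {Q' : (ℕ → Fin (n + 1) ⊕ Fin k') → Prop}
    (hQ : ∀ π π', (∀ i, fanClass (π i) = fanClass (π' i)) → Q π → Q' π')
    (h : ∃ σ : Strategy (fanModel p n k) m, ∀ π ∈ Out σ s, Q π) :
    ∃ σ : Strategy (fanModel p n k') m, ∀ π ∈ Out σ s', Q' π := by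
  obtain ⟨σ, hσ⟩ := h
  obtain ⟨σ', hσ'⟩ := exists_simulating_strategy p hk hk' hm σ
  refine ⟨σ', ?_⟩
  rintro π' ⟨rfl, hπ'⟩
  obtain ⟨π, h0, hπ, hππ⟩ := exists_path_of_simulation (R := fun s s' => fanClass s = fanClass s')
    (E := fun s t => (s, t) ∈ (fanModel p n k).edges \ σ.choice s)
    (E' := fun s t => (s, t) ∈ (fanModel p n k').edges \ σ'.choice s) hσ' hs hπ'
  exact hQ π π' hππ (hσ π ⟨h0, hπ⟩)

mutual

/-- OL formulae with bounds at most `n` cannot tell apart states of the same class in two fans with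
at least `n + 2` edges each. -/
theorem satAt_iff_of_fanClass_eq (p : At) {n k k' : ℕ} [NeZero k] [NeZero k']
    (hk : n + 2 ≤ k) (hk' : n + 2 ≤ k') (φ : Formula At) (hφ : φ.maxBound ≤ n)
    (s : Fin (n + 1) ⊕ Fin k) (s' : Fin (n + 1) ⊕ Fin k') (hs : fanClass s = fanClass s') :
    SatAt (fanModel p n k) φ s ↔ SatAt (fanModel p n k') φ s' := by
  cases φ with
  | top => simp only [SatAt]
  | atom q =>
    simp only [SatAt]
    exact mem_val_iff_of_fanClass_eq p q hs
  | neg φ =>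
    rw [Formula.maxBound] at hφ
    simp only [SatAt, satAt_iff_of_fanClass_eq p hk hk' φ hφ s s' hs]
  | and φ ψ =>
    rw [Formula.maxBound, max_le_iff] at hφ
    simp only [SatAt, satAt_iff_of_fanClass_eq p hk hk' φ hφ.1 s s' hs,
      satAt_iff_of_fanClass_eq p hk hk' ψ hφ.2 s s' hs]
  | demon m ψ =>
    rw [Formula.maxBound, max_le_iff] at hφ
    have ih := pathSat_iff_of_fanClass_eq p hk hk' ψ hφ.2
    simp only [SatAt]
    exact ⟨exists_strategy_of_fanClass_eq p hk hk' hφ.1 hs fun π π' h => (ih π π' h).1,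
      exists_strategy_of_fanClass_eq p hk' hk hφ.1 hs.symm
        fun π' π h => (ih π π' fun i => (h i).symm).2⟩

theorem pathSat_iff_of_fanClass_eq (p : At) {n k k' : ℕ} [NeZero k] [NeZero k']
    (hk : n + 2 ≤ k) (hk' : n + 2 ≤ k') (ψ : PathFormula At) (hψ : ψ.maxBound ≤ n)
    (π : ℕ → Fin (n + 1) ⊕ Fin k) (π' : ℕ → Fin (n + 1) ⊕ Fin k')
    (hπ : ∀ i, fanClass (π i) = fanClass (π' i)) :
    PathSat (fanModel p n k) ψ π ↔ PathSat (fanModel p n k') ψ π' := by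
  cases ψ with
  | next φ =>
    rw [PathFormula.maxBound] at hψ
    simp only [PathSat, satAt_iff_of_fanClass_eq p hk hk' φ hψ _ _ (hπ _)]
  | untl φ ψ =>
    rw [PathFormula.maxBound, max_le_iff] at hψ
    simp only [PathSat, satAt_iff_of_fanClass_eq p hk hk' φ hψ.1 _ _ (hπ _),
      satAt_iff_of_fanClass_eq p hk hk' ψ hψ.2 _ _ (hπ _)]
  | release φ ψ =>
    rw [PathFormula.maxBound, max_le_iff] at hψ
    simp only [PathSat, satAt_iff_of_fanClass_eq p hk hk' φ hψ.1 _ _ (hπ _),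
      satAt_iff_of_fanClass_eq p hk hk' ψ hψ.2 _ _ (hπ _)]

end

end OL

/-! ### Comparison of the two logics -/

theorem theorem4 {At : Type*} (p : At) :
    ¬ ExpressivityLE (SDL.semantics At) (OL.semantics At) ∧
    (¬ ∃ ψ : OL.Formula At, EquivalentFormulae (SDL.semantics At) (OL.semantics At)
        (.demon 1 (.sometime (.atom p))) ψ) ∧
    ∀ n : ℕ,
      SDL.Sat (.demon 1 (.sometime (.atom p))) (fan p n (n + 2)) ∧
      ¬ SDL.Sat (.demon 1 (.sometime (.atom p))) (fan p n (n + 3)) ∧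
      ∀ φ : OL.Formula At, φ.maxBound ≤ n →
        (OL.Sat φ (fan p n (n + 2)) ↔ OL.Sat φ (fan p n (n + 3))) := by
  have hOL : ∀ (n : ℕ) (φ : OL.Formula At), φ.maxBound ≤ n →
      (OL.Sat φ (fan p n (n + 2)) ↔ OL.Sat φ (fan p n (n + 3))) := fun n φ hφ =>
    OL.satAt_iff_of_fanClass_eq p le_rfl (by omega) φ hφ _ _ rfl
  have hnot : ¬ ∃ ψ : OL.Formula At, EquivalentFormulae (SDL.semantics At) (OL.semantics At)
      (.demon 1 (.sometime (.atom p))) ψ := by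
    rintro ⟨ψ, hψ⟩
    let n := ψ.maxBound
    exact SDL.not_sat_fan p n <| (hψ _ (fan p n (n + 3))).2 <|
      (hOL n ψ le_rfl).1 <| (hψ _ (fan p n (n + 2))).1 <| SDL.sat_fan p n
  exact ⟨fun h => hnot (h _), hnot, fun n => ⟨SDL.sat_fan p n, SDL.not_sat_fan p n, hOL n⟩⟩
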